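/- \textbf{Theorem.} Let $\Omega_1'$ and $\Omega_2'$ be sets of unary and binary operation symbols, let $\star\mapsto\star^\circ$ be a map $\Omega_2'\to\Omega_2'$, and let $\mathcal E$ be a set of identities in $0,-,+$ and the operations of $\Omega_1'\cup\Omega_2'$ that includes the group laws for $0,-,+$ (the group being written additively but not assumed commutative) and, for all $\star\in\Omega_2'$ and $\omega\in\Omega_1'$, the identities $$a\star^\circ b=b\star a,\quad a\star(b+c)=a\star b+a\star c,\quad \omega(a+b)=\omega(a)+\omega(b),\quad \omega(a)\star b=\omega(a\star b).$$ Let $\mathsf{TC}$ be the category of topological groups with operations determined by these data: its objects are the topological groups with continuous operations $\Omega_1'\cup\Omega_2'$ that satisfy all identities in $\mathcal E$, and its morphisms are the continuous group homomorphisms that preserve these operations. A \emph{split extension} of $B$ by $A$ in $\mathsf{TC}$ consists of morphisms $i\colon A\to E$, $p\colon E\to B$, $s\colon B\to E$ in $\mathsf{TC}$ such that $ps=\mathrm{id}_B$ and $i$ is the kernel of $p$ (an isomorphism onto $p^{-1}(0)$ with the subspace topology). Its \emph{derived actions} of $B$ on $A$ are given by $b\cdot a=s(b)+a-s(b)$ and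 $b\star a=s(b)\star a$ for $\star\in\Omega_2'$, where $A$ is identified with $p^{-1}(0)$. A \emph{crossed module} in $\mathsf{TC}$ is a morphism $\alpha\colon A\to B$ in $\mathsf{TC}$ together with continuous actions $(b,a)\mapsto b\cdot a$ and $(b,a)\mapsto b\star a$ $(\star\in\Omega_2')$ of $B$ on $A$ that are the derived actions of some split extension of $B$ by $A$ in $\mathsf{TC}$, such that for all $b\in B$, $a,a'\in A$, $\star\in\Omega_2'$, writing $a\star b:=b\star^\circ a$, \begin{enumerate} \item $\alpha(b\cdot a)=b+\alpha(a)-b$; \item $\alpha(a)\cdot a'=a+a'-a$; \item $\alpha(a)\star a'=a\star a'$; \item $\alpha(b\star a)=b\star\alpha(a)$ and $\alpha(a\star b)=\alpha(a)\star b$. \end{enumerate} A morphism from $\alpha\colon A\to B$ to $\alpha'\colon A'\to B'$ is a pair of morphisms $f_1\colon A\to A'$, $f_2\colon B\to B'$ in $\mathsf{TC}$ with $f_2\alpha=\alpha' f_1$, $f_1(b\cdot a)=f_2(b)\cdot f_1(a)$ and $f_1(b\star a)=f_2(b)\star f_1(a)$ for all $a\in A$, $b\in B$, $\star\in\Omega_2'$.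 This defines the category $\mathsf{XMod}(\mathsf{TC})$. An \emph{internal category} in $\mathsf{TC}$ is a category whose objects and whose morphisms form objects $C_0$ and $C$ of $\mathsf{TC}$ and whose source and target maps $d_0,d_1\colon C\to C_0$, identity map $\varepsilon\colon C_0\to C$ and composition $C\,{}_{d_1}\!\times_{d_0}C\to C$ are morphisms of $\mathsf{TC}$; it is an \emph{internal groupoid} if every morphism is invertible and inversion $C\to C$ is a morphism of $\mathsf{TC}$. Morphisms of both are the functors whose object and morphism parts are morphisms of $\mathsf{TC}$. Then $\mathsf{XMod}(\mathsf{TC})$ is equivalent to the category $\mathsf{Cat}(\mathsf{TC})$ of internal groupoids in $\mathsf{TC}$, and it is likewise equivalent to the category of internal categories in $\mathsf{TC}$. -/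

import Mathlib

open CategoryTheory

universe u v w

/-- Terms, with variables indexed by `ℕ`, in the group operations `0`, `-`, `+`, further unary
operations `Ω₁` and further binary operations `Ω₂`. -/
inductive OpTerm (Ω₁ : Type v) (Ω₂ : Type w) : Type (max v w)
  | var : ℕ → OpTerm Ω₁ Ω₂
  | zero : OpTerm Ω₁ Ω₂
  | neg : OpTerm Ω₁ Ω₂ → OpTerm Ω₁ Ω₂
  | add : OpTerm Ω₁ Ω₂ → OpTerm Ω₁ Ω₂ → OpTerm Ω₁ Ω₂
  | un : Ω₁ → OpTerm Ω₁ Ω₂ → OpTerm Ω₁ Ω₂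
  | bin : Ω₂ → OpTerm Ω₁ Ω₂ → OpTerm Ω₁ Ω₂ → OpTerm Ω₁ Ω₂

namespace OpTerm

variable {Ω₁ : Type v} {Ω₂ : Type w}

/-- The value of a term at an assignment of the variables. -/
def eval {X : Type u} [Zero X] [Neg X] [Add X] (un₁ : Ω₁ → X → X) (bin₂ : Ω₂ → X → X → X)
    (x : ℕ → X) : OpTerm Ω₁ Ω₂ → X
  | var n => x n
  | zero => 0
  | neg s => -(eval un₁ bin₂ x s)
  | add s t => eval un₁ bin₂ x s + eval un₁ bin₂ x t
  | un ω s => un₁ ω (eval un₁ bin₂ x s)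
  | bin o s t => bin₂ o (eval un₁ bin₂ x s) (eval un₁ bin₂ x t)

theorem map_eval {X : Type*} {Y : Type*} [AddGroup X] [AddGroup Y] (f : X →+ Y)
    (un₁ : Ω₁ → X → X) (bin₂ : Ω₂ → X → X → X) (un₁' : Ω₁ → Y → Y) (bin₂' : Ω₂ → Y → Y → Y)
    (hun : ∀ ω a, f (un₁ ω a) = un₁' ω (f a))
    (hbin : ∀ o a b, f (bin₂ o a b) = bin₂' o (f a) (f b)) (x : ℕ → X) (t : OpTerm Ω₁ Ω₂) :
    f (t.eval un₁ bin₂ x) = t.eval un₁' bin₂' (fun n => f (x n)) := by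
  induction t with
  | var n => rfl
  | zero => exact map_zero f
  | neg s ih => simp only [eval, map_neg, ih]
  | add s t ihs iht => simp only [eval, map_add, ihs, iht]
  | un ω s ih => simp only [eval, hun, ih]
  | bin o s t ihs iht => simp only [eval, hbin, ihs, iht]

end OpTerm

open OpTerm in
/-- The identities that every category of groups with operations has to include: the group laws,
`a ⋆° b = b ⋆ a`, `a ⋆ (b + c) = a ⋆ b + a ⋆ c`, `ω (a + b) = ω a + ω b` and
`ω a ⋆ b = ω (a ⋆ b)`. -/
inductive RequiredLaw {Ω₁ : Type v} {Ω₂ : Type w} (opp : Ω₂ → Ω₂) :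
    OpTerm Ω₁ Ω₂ → OpTerm Ω₁ Ω₂ → Prop
  | add_assoc : RequiredLaw opp (add (add (var 0) (var 1)) (var 2))
      (add (var 0) (add (var 1) (var 2)))
  | zero_add : RequiredLaw opp (add zero (var 0)) (var 0)
  | add_zero : RequiredLaw opp (add (var 0) zero) (var 0)
  | neg_add_cancel : RequiredLaw opp (add (neg (var 0)) (var 0)) zero
  | add_neg_cancel : RequiredLaw opp (add (var 0) (neg (var 0))) zero
  | bin_opp (o : Ω₂) : RequiredLaw opp (bin (opp o) (var 0) (var 1)) (bin o (var 1) (var 0))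
  | bin_add (o : Ω₂) : RequiredLaw opp (bin o (var 0) (add (var 1) (var 2)))
      (add (bin o (var 0) (var 1)) (bin o (var 0) (var 2)))
  | un_add (ω : Ω₁) : RequiredLaw opp (un ω (add (var 0) (var 1)))
      (add (un ω (var 0)) (un ω (var 1)))
  | un_bin (ω : Ω₁) (o : Ω₂) : RequiredLaw opp (bin o (un ω (var 0)) (var 1))
      (un ω (bin o (var 0) (var 1)))

/-- The data `(Ω, E)` that determine a category of (topological) groups with operations:
`Ω₁` and `Ω₂` are the operations other than `-` and `+` (so `0` is the only constant),
`opp` is `⋆ ↦ ⋆°`, and `E` is the set of identities. -/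
structure OperationTheory : Type (max (v + 1) (w + 1)) where
  Ω₁ : Type v
  Ω₂ : Type w
  opp : Ω₂ → Ω₂
  E : Set (OpTerm Ω₁ Ω₂ × OpTerm Ω₁ Ω₂)
  required : ∀ s t, RequiredLaw opp s t → (s, t) ∈ E

/-- Topological groups with operations, for the operations and identities of `T`. -/
structure TopGroupOp (T : OperationTheory.{v, w}) where
  carrier : Type u
  [addGroup : AddGroup carrier]
  [topologicalSpace : TopologicalSpace carrier]
  [isTopologicalAddGroup : IsTopologicalAddGroup carrier]
  un : T.Ω₁ → carrier → carrier
  bin : T.Ω₂ → carrier → carrier → carrier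
  continuous_un : ∀ ω, Continuous (un ω)
  continuous_bin : ∀ o, Continuous fun p : carrier × carrier => bin o p.1 p.2
  satisfies : ∀ e ∈ T.E, ∀ x : ℕ → carrier, e.1.eval un bin x = e.2.eval un bin x

namespace TopGroupOp

variable {T : OperationTheory.{v, w}}

instance : CoeSort (TopGroupOp.{u} T) (Type u) := ⟨carrier⟩

attribute [instance] addGroup topologicalSpace isTopologicalAddGroup

/-- Continuous group homomorphisms that preserve the operations. -/
@[ext]
structure Hom (X Y : TopGroupOp.{u} T) extends X →+ Y where
  map_un' : ∀ ω a, toFun (X.un ω a) = Y.un ω (toFun a)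
  map_bin' : ∀ o a b, toFun (X.bin o a b) = Y.bin o (toFun a) (toFun b)
  continuous_toFun : Continuous toFun

instance (X Y : TopGroupOp.{u} T) : CoeFun (Hom X Y) (fun _ => X → Y) := ⟨fun f => f.toFun⟩

def Hom.id (X : TopGroupOp.{u} T) : Hom X X where
  toAddMonoidHom := AddMonoidHom.id X
  map_un' _ _ := rfl
  map_bin' _ _ _ := rfl
  continuous_toFun := continuous_id

/-- First `f`, then `g`. -/
def Hom.comp {X Y Z : TopGroupOp.{u} T} (f : Hom X Y) (g : Hom Y Z) : Hom X Z where
  toAddMonoidHom := g.toAddMonoidHom.comp f.toAddMonoidHom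
  map_un' ω a := (congrArg g.toFun (f.map_un' ω a)).trans (g.map_un' ω _)
  map_bin' o a b := (congrArg g.toFun (f.map_bin' o a b)).trans (g.map_bin' o _ _)
  continuous_toFun := g.continuous_toFun.comp f.continuous_toFun

/-- The category of topological groups with operations. -/
instance : Category (TopGroupOp.{u} T) where
  Hom := Hom
  id := Hom.id
  comp := Hom.comp

section pullback

variable {X Y Z : TopGroupOp.{u} T} (f : Hom X Z) (g : Hom Y Z)

/-- The subgroup `{(x, y) | f x = g y}` of `X × Y`. -/
abbrev pullbackSubgroup : AddSubgroup (X × Y) :=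
  (f.toAddMonoidHom.comp (AddMonoidHom.fst X Y)).eqLocus
    (g.toAddMonoidHom.comp (AddMonoidHom.snd X Y))

def pullbackUn (ω : T.Ω₁) (p : pullbackSubgroup f g) : pullbackSubgroup f g :=
  ⟨(X.un ω p.1.1, Y.un ω p.1.2),
    (f.map_un' ω p.1.1).trans ((congrArg (Z.un ω) p.2).trans (g.map_un' ω p.1.2).symm)⟩

def pullbackBin (o : T.Ω₂) (p q : pullbackSubgroup f g) : pullbackSubgroup f g :=
  ⟨(X.bin o p.1.1 q.1.1, Y.bin o p.1.2 q.1.2),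
    (f.map_bin' o p.1.1 q.1.1).trans
      ((congrArg₂ (Z.bin o) p.2 q.2).trans (g.map_bin' o p.1.2 q.1.2).symm)⟩

/-- The pullback `{(x, y) | f x = g y}`, with componentwise operations and the subspace topology
of the product. -/
def pullback : TopGroupOp.{u} T where
  carrier := pullbackSubgroup f g
  un := pullbackUn f g
  bin := pullbackBin f g
  continuous_un ω := by
    refine Continuous.subtype_mk (Continuous.prodMk ?_ ?_) _
    · exact (X.continuous_un ω).comp (continuous_fst.comp continuous_subtype_val)
    · exact (Y.continuous_un ω).comp (continuous_snd.comp continuous_subtype_val)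
  continuous_bin o := by
    refine Continuous.subtype_mk (Continuous.prodMk ?_ ?_) _
    · exact (X.continuous_bin o).comp
        (Continuous.prodMk (continuous_fst.comp (continuous_subtype_val.comp continuous_fst))
          (continuous_fst.comp (continuous_subtype_val.comp continuous_snd)))
    · exact (Y.continuous_bin o).comp
        (Continuous.prodMk (continuous_snd.comp (continuous_subtype_val.comp continuous_fst))
          (continuous_snd.comp (continuous_subtype_val.comp continuous_snd)))
  satisfies e he x := by
    refine Subtype.ext (Prod.ext ?_ ?_)
    · have h := OpTerm.map_eval ((AddMonoidHom.fst X Y).comp (pullbackSubgroup f g).subtype)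
        (pullbackUn f g) (pullbackBin f g) X.un X.bin (fun _ _ => rfl) (fun _ _ _ => rfl) x
      exact (h e.1).trans ((X.satisfies e he _).trans (h e.2).symm)
    · have h := OpTerm.map_eval ((AddMonoidHom.snd X Y).comp (pullbackSubgroup f g).subtype)
        (pullbackUn f g) (pullbackBin f g) Y.un Y.bin (fun _ _ => rfl) (fun _ _ _ => rfl) x
      exact (h e.1).trans ((Y.satisfies e he _).trans (h e.2).symm)

end pullback

def pullback.mk {X Y Z : TopGroupOp.{u} T} {f : Hom X Z} {g : Hom Y Z} (x : X) (y : Y)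
    (h : f x = g y) : pullback f g := ⟨(x, y), h⟩

/-- A split extension `0 ⟶ A ⟶ E ⟶ B ⟶ 0`, `s : B ⟶ E`, of topological groups with operations;
`i` is the kernel of `p`, i.e. an isomorphism onto `{e | p e = 0}` with the subspace topology. -/
structure SplitExtension (A B : TopGroupOp.{u} T) where
  E : TopGroupOp.{u} T
  i : Hom A E
  p : Hom E B
  s : Hom B E
  isEmbedding_i : Topology.IsEmbedding i
  exact : ∀ e, p e = 0 ↔ e ∈ Set.range i
  p_s : ∀ b, p (s b) = b

/-- The actions `b · a` and `b ⋆ a` are continuous and are the derived actions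
`b · a = s b + a - s b`, `b ⋆ a = s b ⋆ a` of some split extension. -/
def IsContinuousDerivedAction {A B : TopGroupOp.{u} T} (act : B → A → A)
    (star : T.Ω₂ → B → A → A) : Prop :=
  Continuous (fun p : B × A => act p.1 p.2) ∧
  (∀ o, Continuous fun p : B × A => star o p.1 p.2) ∧
  ∃ S : SplitExtension A B,
    (∀ b a, S.i (act b a) = S.s b + S.i a - S.s b) ∧
    (∀ o b a, S.i (star o b a) = S.E.bin o (S.s b) (S.i a))

end TopGroupOp

open TopGroupOp

/-- Crossed modules `α : A ⟶ B` of topological groups with operations.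
`act b a` is `b · a`, `star o b a` is `b ⋆ a`, and `a ⋆ b` means `b ⋆° a`. -/
structure CrossedModuleOp (T : OperationTheory.{v, w}) where
  A : TopGroupOp.{u} T
  B : TopGroupOp.{u} T
  α : Hom A B
  act : B → A → A
  star : T.Ω₂ → B → A → A
  derived : IsContinuousDerivedAction act star
  cm1 : ∀ b a, α (act b a) = b + α a - b
  cm2 : ∀ a a', act (α a) a' = a + a' - a
  cm3 : ∀ o a a', star o (α a) a' = A.bin o a a'
  cm4_left : ∀ o b a, α (star o b a) = B.bin o b (α a)
  cm4_right : ∀ o a b, α (star (T.opp o) b a) = B.bin o (α a) b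

namespace CrossedModuleOp

variable {T : OperationTheory.{v, w}}

@[ext]
structure Hom (X Y : CrossedModuleOp.{u} T) where
  f₁ : TopGroupOp.Hom X.A Y.A
  f₂ : TopGroupOp.Hom X.B Y.B
  comm : ∀ a, f₂ (X.α a) = Y.α (f₁ a)
  map_act : ∀ b a, f₁ (X.act b a) = Y.act (f₂ b) (f₁ a)
  map_star : ∀ o b a, f₁ (X.star o b a) = Y.star o (f₂ b) (f₁ a)

/-- The category of crossed modules of topological groups with operations. -/
instance : Category (CrossedModuleOp.{u} T) where
  Hom := Hom
  id X := ⟨.id X.A, .id X.B, fun _ => rfl, fun _ _ => rfl, fun _ _ _ => rfl⟩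
  comp f g := {
    f₁ := f.f₁.comp g.f₁
    f₂ := f.f₂.comp g.f₂
    comm := fun a => (congrArg g.f₂.toFun (f.comm a)).trans (g.comm _)
    map_act := fun b a => (congrArg g.f₁.toFun (f.map_act b a)).trans (g.map_act _ _)
    map_star := fun o b a => (congrArg g.f₁.toFun (f.map_star o b a)).trans (g.map_star _ _ _) }

end CrossedModuleOp

/-- Internal categories in the category of topological groups with operations.
The composite `comp (a, b)`, also written `a ∘ b`, is defined for `d₁ a = d₀ b`; it goes from
`d₀ a` to `d₁ b`. -/
structure InternalCatOp (T : OperationTheory.{v, w}) where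
  Obj : TopGroupOp.{u} T
  Mor : TopGroupOp.{u} T
  d₀ : TopGroupOp.Hom Mor Obj
  d₁ : TopGroupOp.Hom Mor Obj
  ε : TopGroupOp.Hom Obj Mor
  comp : TopGroupOp.Hom (pullback d₁ d₀) Mor
  d₀_ε : ∀ x, d₀ (ε x) = x
  d₁_ε : ∀ x, d₁ (ε x) = x
  d₀_comp : ∀ a b (h : d₁ a = d₀ b), d₀ (comp (pullback.mk a b h)) = d₀ a
  d₁_comp : ∀ a b (h : d₁ a = d₀ b), d₁ (comp (pullback.mk a b h)) = d₁ b
  ε_comp : ∀ a, comp (pullback.mk (ε (d₀ a)) a (d₁_ε _)) = a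
  comp_ε : ∀ a, comp (pullback.mk a (ε (d₁ a)) (d₀_ε _).symm) = a
  assoc : ∀ a b c (h : d₁ a = d₀ b) (h' : d₁ b = d₀ c),
    comp (pullback.mk (comp (pullback.mk a b h)) c ((d₁_comp a b h).trans h')) =
      comp (pullback.mk a (comp (pullback.mk b c h')) (h.trans (d₀_comp b c h').symm))

namespace InternalCatOp

variable {T : OperationTheory.{v, w}}

/-- Internal functors. -/
@[ext]
structure Hom (C D : InternalCatOp.{u} T) where
  obj : TopGroupOp.Hom C.Obj D.Obj
  mor : TopGroupOp.Hom C.Mor D.Mor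
  d₀_mor : ∀ a, D.d₀ (mor a) = obj (C.d₀ a)
  d₁_mor : ∀ a, D.d₁ (mor a) = obj (C.d₁ a)
  mor_ε : ∀ x, mor (C.ε x) = D.ε (obj x)
  mor_comp : ∀ a b (h : C.d₁ a = C.d₀ b), mor (C.comp (pullback.mk a b h)) =
    D.comp (pullback.mk (mor a) (mor b)
      ((d₁_mor a).trans ((congrArg obj.toFun h).trans (d₀_mor b).symm)))

/-- The category of internal categories in the category of topological groups with operations. -/
instance : Category (InternalCatOp.{u} T) where
  Hom := Hom
  id C := ⟨.id C.Obj, .id C.Mor, fun _ => rfl, fun _ => rfl, fun _ => rfl, fun _ _ _ => rfl⟩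
  comp f g := {
    obj := f.obj.comp g.obj
    mor := f.mor.comp g.mor
    d₀_mor := fun a => (g.d₀_mor _).trans (congrArg g.obj.toFun (f.d₀_mor a))
    d₁_mor := fun a => (g.d₁_mor _).trans (congrArg g.obj.toFun (f.d₁_mor a))
    mor_ε := fun x => (congrArg g.mor.toFun (f.mor_ε x)).trans (g.mor_ε _)
    mor_comp := fun a b h => (congrArg g.mor.toFun (f.mor_comp a b h)).trans (g.mor_comp _ _ _) }

/-- An internal category is an internal groupoid if it has an inversion map that is a morphism
of topological groups with operations. -/
def IsGroupoid : ObjectProperty (InternalCatOp.{u} T) := fun C =>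
  ∃ (inv : TopGroupOp.Hom C.Mor C.Mor) (h₀ : ∀ a, C.d₀ (inv a) = C.d₁ a)
    (h₁ : ∀ a, C.d₁ (inv a) = C.d₀ a),
    (∀ a, C.comp (pullback.mk a (inv a) (h₀ a).symm) = C.ε (C.d₀ a)) ∧
    (∀ a, C.comp (pullback.mk (inv a) a (h₁ a)) = C.ε (C.d₁ a))

end InternalCatOp

/-- The category of internal groupoids: morphisms are the internal functors. -/
abbrev InternalGroupoidOp (T : OperationTheory.{v, w}) :=
  (InternalCatOp.IsGroupoid.{u} (T := T)).FullSubcategory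

/-! ### Laws used in proofs, morphisms and kernels -/

namespace TopGroupOp

variable {T : OperationTheory.{v, w}}

/-! An internal category is sent to the restriction of `d₁` to the kernel of `d₀`, with `Obj` acting
through `ε`; this functor is shown to be fully faithful and essentially surjective.

Two facts carry the proof. First, since composition is a homomorphism, it is forced: `comp_eq` and
`comp_eq'` give `a ∘ b = a - ε (d₁ a) + b = b - ε (d₁ a) + a`. Hence inverses exist (so internal
categories are groupoids), morphisms compatible with `d₁` and `ε` preserve composition, and equality
of the two formulas is the Peiffer identity `cm2`. Second, each element of a split extension is
uniquely `i a + s b`, and the actions determine the operations (`r_add`, `r_un`, `r_bin`). So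
morphisms out of it can be given on `A` and `B` separately (`desc`, `hom_ext`), which yields full
faithfulness.

For essential surjectivity, the split extension `E` supplied by `derived` serves as the object of
morphisms, so the identities need not be checked on a semidirect product. The target is `i a + s b ↦
α a + b`, and `cm2`, `cm3` make composition a homomorphism. -/

theorem bin_opp (X : TopGroupOp.{u} T) (o : T.Ω₂) (a b : X) :
    X.bin (T.opp o) a b = X.bin o b a :=
  X.satisfies _ (T.required _ _ (.bin_opp o)) fun n => match n with | 0 => a | _ => b

theorem bin_add (X : TopGroupOp.{u} T) (o : T.Ω₂) (a b c : X) :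
    X.bin o a (b + c) = X.bin o a b + X.bin o a c :=
  X.satisfies _ (T.required _ _ (.bin_add o)) fun n => match n with | 0 => a | 1 => b | _ => c

theorem add_bin (X : TopGroupOp.{u} T) (o : T.Ω₂) (a b c : X) :
    X.bin o (a + b) c = X.bin o a c + X.bin o b c := by
  simp only [← X.bin_opp o, X.bin_add]

theorem un_add (X : TopGroupOp.{u} T) (ω : T.Ω₁) (a b : X) :
    X.un ω (a + b) = X.un ω a + X.un ω b :=
  X.satisfies _ (T.required _ _ (.un_add ω)) fun n => match n with | 0 => a | _ => b

theorem un_zero (X : TopGroupOp.{u} T) (ω : T.Ω₁) : X.un ω 0 = 0 := by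
  have h := X.un_add ω 0 0
  rwa [add_zero, left_eq_add] at h

theorem bin_zero (X : TopGroupOp.{u} T) (o : T.Ω₂) (a : X) : X.bin o a 0 = 0 := by
  have h := X.bin_add o a 0 0
  rwa [add_zero, left_eq_add] at h

namespace Hom

variable {X Y Z : TopGroupOp.{u} T}

theorem ext_apply {f g : Hom X Y} (h : ∀ a, f a = g a) : f = g :=
  Hom.ext (funext h)

theorem map_zero (f : Hom X Y) : f 0 = 0 := f.toAddMonoidHom.map_zero

theorem map_add (f : Hom X Y) (a b : X) : f (a + b) = f a + f b := f.toAddMonoidHom.map_add a b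

theorem map_neg (f : Hom X Y) (a : X) : f (-a) = -f a := f.toAddMonoidHom.map_neg a

theorem map_sub (f : Hom X Y) (a b : X) : f (a - b) = f a - f b := f.toAddMonoidHom.map_sub a b

theorem map_un (f : Hom X Y) (ω : T.Ω₁) (a : X) : f (X.un ω a) = Y.un ω (f a) := f.map_un' ω a

theorem map_bin (f : Hom X Y) (o : T.Ω₂) (a b : X) : f (X.bin o a b) = Y.bin o (f a) (f b) :=
  f.map_bin' o a b

theorem continuous (f : Hom X Y) : Continuous f := f.continuous_toFun

/-- A morphism from an additive map that is compatible with the operations. -/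
def mk' (f : X → Y) (hadd : ∀ a b, f (a + b) = f a + f b)
    (hun : ∀ ω a, f (X.un ω a) = Y.un ω (f a))
    (hbin : ∀ o a b, f (X.bin o a b) = Y.bin o (f a) (f b)) (hf : Continuous f) : Hom X Y where
  toAddMonoidHom := AddMonoidHom.mk' f hadd
  map_un' := hun
  map_bin' := hbin
  continuous_toFun := hf

@[simp]
theorem comp_apply (f : Hom X Y) (g : Hom Y Z) (a : X) : f.comp g a = g (f a) := rfl

end Hom

section kernel

variable {X Y : TopGroupOp.{u} T} (f : Hom X Y)

def kernelUn (ω : T.Ω₁) (a : f.toAddMonoidHom.ker) : f.toAddMonoidHom.ker :=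
  ⟨X.un ω a.1, (f.map_un ω a.1).trans ((congrArg (Y.un ω) a.2).trans (Y.un_zero ω))⟩

def kernelBin (o : T.Ω₂) (a b : f.toAddMonoidHom.ker) : f.toAddMonoidHom.ker :=
  ⟨X.bin o a.1 b.1, (f.map_bin o a.1 b.1).trans ((congrArg (Y.bin o _) b.2).trans (Y.bin_zero o _))⟩

/-- The kernel of a morphism, with the subspace topology. -/
def kernel : TopGroupOp.{u} T where
  carrier := f.toAddMonoidHom.ker
  un := kernelUn f
  bin := kernelBin f
  continuous_un ω := ((X.continuous_un ω).comp continuous_subtype_val).subtype_mk _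
  continuous_bin o := ((X.continuous_bin o).comp
    ((continuous_subtype_val.comp continuous_fst).prodMk
      (continuous_subtype_val.comp continuous_snd))).subtype_mk _
  satisfies e he x := by
    refine Subtype.ext ?_
    have h := OpTerm.map_eval f.toAddMonoidHom.ker.subtype
      (kernelUn f) (kernelBin f) X.un X.bin (fun _ _ => rfl) (fun _ _ _ => rfl) x
    exact (h e.1).trans ((X.satisfies e he _).trans (h e.2).symm)

/-- The inclusion of the kernel. -/
def kernelι : Hom (kernel f) X where
  toAddMonoidHom := f.toAddMonoidHom.ker.subtype
  map_un' _ _ := rfl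
  map_bin' _ _ _ := rfl
  continuous_toFun := continuous_subtype_val

theorem kernelι_injective : Function.Injective (kernelι f) := Subtype.val_injective

theorem isEmbedding_kernelι : Topology.IsEmbedding (kernelι f) := Topology.IsEmbedding.subtypeVal

theorem map_kernelι (a : kernel f) : f (kernelι f a) = 0 := a.2

variable {f}

def kernel.mk (x : X) (h : f x = 0) : kernel f := ⟨x, h⟩

@[simp]
theorem kernelι_mk (x : X) (h : f x = 0) : kernelι f (kernel.mk x h) = x := rfl

theorem kernel.continuous_mk {Z : Type*} [TopologicalSpace Z] {g : Z → X} (hg : Continuous g)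
    (h : ∀ z, f (g z) = 0) : Continuous fun z => kernel.mk (g z) (h z) :=
  hg.subtype_mk _

end kernel

/-! ### Split extensions and morphisms out of them -/

namespace SplitExtension

variable {A B : TopGroupOp.{u} T} (S : SplitExtension A B)

theorem i_injective : Function.Injective S.i := S.isEmbedding_i.injective

theorem p_i (a : A) : S.p (S.i a) = 0 := (S.exact _).2 ⟨a, rfl⟩

theorem exists_i_eq (e : S.E) : ∃ a, S.i a = e - S.s (S.p e) :=
  (S.exact _).1 (by rw [Hom.map_sub, S.p_s, sub_self])

/-- The map `e ↦ e - s (p e)` to the kernel. -/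
noncomputable def r (e : S.E) : A := (S.exists_i_eq e).choose

theorem i_r (e : S.E) : S.i (S.r e) = e - S.s (S.p e) := (S.exists_i_eq e).choose_spec

theorem i_r_add (e : S.E) : S.i (S.r e) + S.s (S.p e) = e := by rw [i_r, sub_add_cancel]

theorem r_eq {e : S.E} {a : A} (h : S.i a = e - S.s (S.p e)) : S.r e = a :=
  S.i_injective ((S.i_r e).trans h.symm)

theorem r_i (a : A) : S.r (S.i a) = a :=
  S.r_eq (by rw [S.p_i, Hom.map_zero, sub_zero])

theorem r_s (b : B) : S.r (S.s b) = 0 :=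
  S.r_eq (by rw [S.p_s, Hom.map_zero, sub_self])

/-- The kernel carries the subspace topology, so continuity can be tested after `i`, where the map
is `e ↦ e - s (p e)`. -/
theorem continuous_r : Continuous S.r := by
  rw [S.isEmbedding_i.continuous_iff]
  have h : S.i ∘ S.r = fun e => e - S.s (S.p e) := funext S.i_r
  rw [h]
  exact continuous_id.sub (S.s.continuous.comp S.p.continuous)

theorem i_r_of_p_eq_zero {e : S.E} (h : S.p e = 0) : S.i (S.r e) = e := by
  rw [i_r, h, Hom.map_zero, sub_zero]

/-- The action `b · a = s b + a - s b`. -/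
noncomputable def conj (b : B) (a : A) : A := S.r (S.s b + S.i a - S.s b)

theorem i_conj (b : B) (a : A) : S.i (S.conj b a) = S.s b + S.i a - S.s b :=
  S.i_r_of_p_eq_zero (by rw [Hom.map_sub, Hom.map_add, S.p_i, add_zero, sub_self])

/-- The action `b ⋆ a = s b ⋆ a`. -/
noncomputable def binAct (o : T.Ω₂) (b : B) (a : A) : A := S.r (S.E.bin o (S.s b) (S.i a))

theorem i_binAct (o : T.Ω₂) (b : B) (a : A) :
    S.i (S.binAct o b a) = S.E.bin o (S.s b) (S.i a) :=
  S.i_r_of_p_eq_zero (by rw [Hom.map_bin, S.p_i, bin_zero])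

/-- Moving `s (p x)` past `i (r y)` costs a conjugation: in the coordinates `(r, p)`, addition is
that of a semidirect product. -/
theorem r_add (x y : S.E) : S.r (x + y) = S.r x + S.conj (S.p x) (S.r y) := by
  apply S.r_eq
  simp only [Hom.map_add, i_conj, i_r, sub_eq_add_neg, neg_add_rev, add_assoc,
    neg_add_cancel_left]

theorem r_un (ω : T.Ω₁) (x : S.E) : S.r (S.E.un ω x) = A.un ω (S.r x) := by
  apply S.r_eq
  rw [eq_sub_iff_add_eq, Hom.map_un, Hom.map_un, Hom.map_un, ← un_add, i_r_add]

/-- Expand the product of `i (r x) + s (p x)` and `i (r y) + s (p y)`; the last of the four terms is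
`s (p (x ⋆ y))`. Addition need not commute: the order of terms is that obtained by splitting the
second factor first. -/
theorem r_bin (o : T.Ω₂) (x y : S.E) : S.r (S.E.bin o x y) =
    A.bin o (S.r x) (S.r y) + S.binAct o (S.p x) (S.r y) +
      S.binAct (T.opp o) (S.p y) (S.r x) := by
  apply S.r_eq
  rw [eq_sub_iff_add_eq]
  conv_rhs => rw [← S.i_r_add x, ← S.i_r_add y]
  simp only [Hom.map_add, i_binAct, Hom.map_bin, bin_opp, add_bin, bin_add, add_assoc]

theorem hom_ext {Z : TopGroupOp.{u} T} {f g : Hom S.E Z} (hi : ∀ a, f (S.i a) = g (S.i a))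
    (hs : ∀ b, f (S.s b) = g (S.s b)) : f = g :=
  Hom.ext_apply fun e => by rw [← S.i_r_add e, Hom.map_add, Hom.map_add, hi, hs]

variable {Z : TopGroupOp.{u} T} (g : Hom A Z) (h : Hom B Z)

/-- The morphism out of a split extension that is given on the kernel and on the quotient. -/
noncomputable def desc (hact : ∀ b a, g (S.conj b a) = h b + g a - h b)
    (hbin : ∀ o b a, g (S.binAct o b a) = Z.bin o (h b) (g a)) : Hom S.E Z :=
  Hom.mk' (fun e => g (S.r e) + h (S.p e))
    -- The action term of `r_add` becomes conjugation by `h (p x)`, whose trailing `-h (p x)`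
    -- cancels.
    (fun x y => by
      simp only [r_add, Hom.map_add, hact, sub_eq_add_neg, add_assoc, neg_add_cancel_left])
    (fun ω x => by simp only [r_un, Hom.map_un, un_add])
    (fun o x y => by
      simp only [r_bin, Hom.map_add, Hom.map_bin, hbin, bin_opp, add_bin, bin_add, add_assoc])
    ((g.continuous.comp S.continuous_r).add (h.continuous.comp S.p.continuous))

variable (hact : ∀ b a, g (S.conj b a) = h b + g a - h b)
    (hbin : ∀ o b a, g (S.binAct o b a) = Z.bin o (h b) (g a))

theorem desc_apply (e : S.E) : S.desc g h hact hbin e = g (S.r e) + h (S.p e) := rfl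

theorem desc_i (a : A) : S.desc g h hact hbin (S.i a) = g a := by
  rw [desc_apply, r_i, p_i, Hom.map_zero, add_zero]

theorem desc_s (b : B) : S.desc g h hact hbin (S.s b) = h b := by
  rw [desc_apply, r_s, p_s, Hom.map_zero, zero_add]

end SplitExtension

end TopGroupOp

/-! ### Composition is forced and inverses exist -/

namespace InternalCatOp

variable {T : OperationTheory.{v, w}} (C : InternalCatOp.{u} T)

theorem comp_mk_congr {a a' b b' : C.Mor} (ha : a = a') (hb : b = b') (h : C.d₁ a = C.d₀ b)
    (h' : C.d₁ a' = C.d₀ b') : C.comp (pullback.mk a b h) = C.comp (pullback.mk a' b' h') := by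
  subst ha hb; rfl

theorem comp_add (a b a' b' : C.Mor) (h : C.d₁ a = C.d₀ b) (h' : C.d₁ a' = C.d₀ b') :
    C.comp (pullback.mk (a + a') (b + b')
      (by rw [Hom.map_add, Hom.map_add, h, h'])) =
      C.comp (pullback.mk a b h) + C.comp (pullback.mk a' b' h') :=
  C.comp.map_add (pullback.mk a b h) (pullback.mk a' b' h')

theorem comp_un (ω : T.Ω₁) (a b : C.Mor) (h : C.d₁ a = C.d₀ b) :
    C.comp (pullback.mk (C.Mor.un ω a) (C.Mor.un ω b) (by rw [Hom.map_un, Hom.map_un, h])) =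
      C.Mor.un ω (C.comp (pullback.mk a b h)) :=
  C.comp.map_un ω (pullback.mk a b h)

theorem comp_bin (o : T.Ω₂) (a b a' b' : C.Mor) (h : C.d₁ a = C.d₀ b) (h' : C.d₁ a' = C.d₀ b') :
    C.comp (pullback.mk (C.Mor.bin o a a') (C.Mor.bin o b b')
      (by rw [Hom.map_bin, Hom.map_bin, h, h'])) =
      C.Mor.bin o (C.comp (pullback.mk a b h)) (C.comp (pullback.mk a' b' h')) :=
  C.comp.map_bin o (pullback.mk a b h) (pullback.mk a' b' h')

theorem zero_comp (b : C.Mor) (h : C.d₀ b = 0) :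
    C.comp (pullback.mk 0 b (by rw [Hom.map_zero, h])) = b := by
  rw [← C.comp_mk_congr (a := C.ε (C.d₀ b)) (by rw [h, Hom.map_zero]) rfl (C.d₁_ε _), C.ε_comp]

/-- Interchange law for `(a, b) = (a, ε (d₁ a)) + (0, -ε (d₁ a) + b)`: both summands compose by a
unit law, as `0 = ε 0`. -/
theorem comp_eq (a b : C.Mor) (h : C.d₁ a = C.d₀ b) :
    C.comp (pullback.mk a b h) = a - C.ε (C.d₁ a) + b := by
  have h0 : C.d₀ (-C.ε (C.d₁ a) + b) = 0 := by
    rw [Hom.map_add, Hom.map_neg, d₀_ε, h, neg_add_cancel]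
  have key := C.comp_add a (C.ε (C.d₁ a)) 0 (-C.ε (C.d₁ a) + b) (C.d₀_ε _).symm
    (by rw [Hom.map_zero, h0])
  rw [C.comp_ε, C.zero_comp _ h0] at key
  rw [sub_eq_add_neg, add_assoc, ← key]
  exact C.comp_mk_congr (add_zero a).symm (add_neg_cancel_left _ _).symm _ _

/-- The same argument with the summand containing `0` placed first. -/
theorem comp_eq' (a b : C.Mor) (h : C.d₁ a = C.d₀ b) :
    C.comp (pullback.mk a b h) = b - C.ε (C.d₁ a) + a := by
  have h0 : C.d₀ (b - C.ε (C.d₁ a)) = 0 := by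
    rw [Hom.map_sub, d₀_ε, h, sub_self]
  have key := C.comp_add 0 (b - C.ε (C.d₁ a)) a (C.ε (C.d₁ a))
    (by rw [Hom.map_zero, h0]) (C.d₀_ε _).symm
  rw [C.comp_ε, C.zero_comp _ h0] at key
  rw [← key]
  exact C.comp_mk_congr (zero_add a).symm (sub_add_cancel _ _).symm _ _

/-- The inverse of a morphism. -/
def inv (a : C.Mor) : C.Mor := C.ε (C.d₁ a) - a + C.ε (C.d₀ a)

theorem d₀_inv (a : C.Mor) : C.d₀ (C.inv a) = C.d₁ a := by
  rw [inv, Hom.map_add, Hom.map_sub, d₀_ε, d₀_ε, sub_add_cancel]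

theorem d₁_inv (a : C.Mor) : C.d₁ (C.inv a) = C.d₀ a := by
  rw [inv, Hom.map_add, Hom.map_sub, d₁_ε, d₁_ε, sub_self, zero_add]

theorem comp_inv (a : C.Mor) :
    C.comp (pullback.mk a (C.inv a) (C.d₀_inv a).symm) = C.ε (C.d₀ a) := by
  rw [comp_eq, inv, ← add_assoc, sub_add_sub_cancel, sub_self, zero_add]

theorem inv_comp (a : C.Mor) :
    C.comp (pullback.mk (C.inv a) a (C.d₁_inv a)) = C.ε (C.d₁ a) := by
  rw [comp_eq, d₁_inv, inv, add_sub_cancel_right, sub_add_cancel]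

theorem eq_inv (a b : C.Mor) (h : C.d₁ a = C.d₀ b)
    (hab : C.comp (pullback.mk a b h) = C.ε (C.d₀ a)) : b = C.inv a := by
  rw [inv, ← hab, comp_eq, ← add_assoc, sub_add_sub_cancel, sub_self, zero_add]

/-- Inversion is a morphism. -/
def invHom : TopGroupOp.Hom C.Mor C.Mor :=
  TopGroupOp.Hom.mk' C.inv
    (fun a b => by
      -- The formula for `inv` is not visibly additive; instead, by interchange, the sum of inverses
      -- is a right inverse of the sum, and right inverses are unique.
      refine (C.eq_inv _ _ ?_ ?_).symm
      · rw [Hom.map_add, Hom.map_add, d₀_inv, d₀_inv]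
      · rw [C.comp_add a _ b _ (C.d₀_inv a).symm (C.d₀_inv b).symm, comp_inv, comp_inv,
          Hom.map_add, Hom.map_add])
    (fun ω a => by
      refine (C.eq_inv _ _ ?_ ?_).symm
      · rw [Hom.map_un, Hom.map_un, d₀_inv]
      · rw [C.comp_un ω a _ (C.d₀_inv a).symm, comp_inv, Hom.map_un, Hom.map_un])
    (fun o a b => by
      refine (C.eq_inv _ _ ?_ ?_).symm
      · rw [Hom.map_bin, Hom.map_bin, d₀_inv, d₀_inv]
      · rw [C.comp_bin o a _ b _ (C.d₀_inv a).symm (C.d₀_inv b).symm, comp_inv, comp_inv,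
          Hom.map_bin, Hom.map_bin])
    (((C.ε.continuous.comp C.d₁.continuous).sub continuous_id).add
      (C.ε.continuous.comp C.d₀.continuous))

theorem isGroupoid : IsGroupoid C :=
  ⟨C.invHom, C.d₀_inv, C.d₁_inv, C.comp_inv, C.inv_comp⟩

/-- The Peiffer identity: compare the two formulas for the composite of `a` with `ε (d₁ a) + a'`. -/
theorem ε_d₁_add_sub (a a' : C.Mor) (h' : C.d₀ a' = 0) :
    C.ε (C.d₁ a) + a' - C.ε (C.d₁ a) = a + a' - a := by
  have h : C.d₁ a = C.d₀ (C.ε (C.d₁ a) + a') := by rw [Hom.map_add, d₀_ε, h', add_zero]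
  have key := (C.comp_eq a _ h).symm.trans (C.comp_eq' a _ h)
  rw [← add_assoc, sub_add_cancel] at key
  rw [key, add_sub_cancel_right]

/-- Interchange of `⋆` with composition for the pairs `(a, ε (d₁ a))` and `(0, a')`, where `a ⋆ 0 =
0`. -/
theorem bin_ε_d₁ (o : T.Ω₂) (a a' : C.Mor) (h' : C.d₀ a' = 0) :
    C.Mor.bin o (C.ε (C.d₁ a)) a' = C.Mor.bin o a a' := by
  have key := C.comp_bin o a (C.ε (C.d₁ a)) 0 a' (C.d₀_ε _).symm (by rw [Hom.map_zero, h'])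
  have h0 : C.d₀ (C.Mor.bin o (C.ε (C.d₁ a)) a') = 0 := by rw [Hom.map_bin, h', bin_zero]
  rw [C.comp_ε, C.zero_comp a' h'] at key
  exact (C.zero_comp _ h0).symm.trans
    ((C.comp_mk_congr (bin_zero _ _ _).symm rfl _ _).trans key)

/-! ### The crossed module of an internal category -/

/-- The split extension `ker d₀ ⟶ Mor ⟶ Obj`. -/
def splitExtension : SplitExtension (kernel C.d₀) C.Obj where
  E := C.Mor
  i := kernelι C.d₀
  p := C.d₀
  s := C.ε
  isEmbedding_i := isEmbedding_kernelι C.d₀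
  exact e := ⟨fun h => ⟨kernel.mk e h, rfl⟩, fun ⟨a, ha⟩ => ha ▸ map_kernelι C.d₀ a⟩
  p_s := C.d₀_ε

/-- The crossed module `d₁ : ker d₀ ⟶ Obj` of an internal category. -/
abbrev crossedModule : CrossedModuleOp.{u} T where
  A := kernel C.d₀
  B := C.Obj
  α := (kernelι C.d₀).comp C.d₁
  act b a := kernel.mk (C.ε b + kernelι C.d₀ a - C.ε b) (by
    rw [Hom.map_sub, Hom.map_add, map_kernelι, add_zero, sub_self])
  star o b a := kernel.mk (C.Mor.bin o (C.ε b) (kernelι C.d₀ a)) (by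
    rw [Hom.map_bin, map_kernelι, bin_zero])
  derived := by
    have hε : Continuous fun q : C.Obj × kernel C.d₀ => C.ε q.1 :=
      C.ε.continuous.comp continuous_fst
    have hι : Continuous fun q : C.Obj × kernel C.d₀ => kernelι C.d₀ q.2 :=
      (kernelι C.d₀).continuous.comp continuous_snd
    exact ⟨kernel.continuous_mk ((hε.add hι).sub hε) _,
      fun o => kernel.continuous_mk ((C.Mor.continuous_bin o).comp (hε.prodMk hι)) _,
      C.splitExtension, fun _ _ => rfl, fun _ _ _ => rfl⟩
  cm1 b a := by
    simp only [Hom.comp_apply, kernelι_mk, Hom.map_add, Hom.map_sub, d₁_ε]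
  cm2 a a' := kernelι_injective _ (by
    simp only [Hom.comp_apply, kernelι_mk, Hom.map_add, Hom.map_sub]
    exact C.ε_d₁_add_sub _ _ (map_kernelι _ _))
  cm3 o a a' := kernelι_injective _ (by
    simp only [Hom.comp_apply, kernelι_mk, Hom.map_bin]
    exact C.bin_ε_d₁ o _ _ (map_kernelι _ _))
  cm4_left o b a := by
    simp only [Hom.comp_apply, kernelι_mk, Hom.map_bin, d₁_ε]
  cm4_right o a b := by
    simp only [Hom.comp_apply, kernelι_mk, Hom.map_bin, d₁_ε, bin_opp]

/-! ### Functoriality and full faithfulness -/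

variable {C}
variable {D : InternalCatOp.{u} T}

/-- The restriction of an internal functor to the kernels of the source maps. -/
def Hom.kernelMap (f : Hom C D) : TopGroupOp.Hom (kernel C.d₀) (kernel D.d₀) :=
  have h (a : kernel C.d₀) : D.d₀ (f.mor (kernelι C.d₀ a)) = 0 := by
    rw [f.d₀_mor, map_kernelι, TopGroupOp.Hom.map_zero]
  TopGroupOp.Hom.mk' (fun a => kernel.mk (f.mor (kernelι C.d₀ a)) (h a))
    (fun a b => kernelι_injective _ (f.mor.map_add (kernelι C.d₀ a) (kernelι C.d₀ b)))
    (fun ω a => kernelι_injective _ (f.mor.map_un ω (kernelι C.d₀ a)))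
    (fun o a b => kernelι_injective _ (f.mor.map_bin o (kernelι C.d₀ a) (kernelι C.d₀ b)))
    (kernel.continuous_mk (f.mor.continuous.comp (kernelι C.d₀).continuous) _)

theorem Hom.kernelι_kernelMap (f : Hom C D) (a : kernel C.d₀) :
    kernelι D.d₀ (f.kernelMap a) = f.mor (kernelι C.d₀ a) := rfl

/-- The morphism of crossed modules of an internal functor. -/
def Hom.crossedModuleMap (f : Hom C D) :
    CrossedModuleOp.Hom C.crossedModule D.crossedModule where
  f₁ := f.kernelMap
  f₂ := f.obj
  comm a := (f.d₁_mor _).symm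
  map_act b a := kernelι_injective D.d₀ (by
    simp only [crossedModule, kernelι_kernelMap, kernelι_mk, TopGroupOp.Hom.map_add,
      TopGroupOp.Hom.map_sub, f.mor_ε])
  map_star o b a := kernelι_injective D.d₀ (by
    simp only [crossedModule, kernelι_kernelMap, kernelι_mk, TopGroupOp.Hom.map_bin, f.mor_ε])

variable (T) in
/-- The functor from internal categories to crossed modules. -/
def toCrossedModule : InternalCatOp.{u} T ⥤ CrossedModuleOp.{u} T where
  obj C := C.crossedModule
  map f := Hom.crossedModuleMap f
  map_id _ := rfl
  map_comp _ _ := rfl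

/-- `Mor` is generated by the kernel of `d₀`, where `f₁` determines the functor, and the identities,
where `f₂` does. -/
theorem Hom.crossedModuleMap_injective :
    Function.Injective (Hom.crossedModuleMap : Hom C D → _) := by
  intro f g hfg
  have h₂ : f.obj = g.obj := congrArg CrossedModuleOp.Hom.f₂ hfg
  have h₁ : f.kernelMap = g.kernelMap := congrArg CrossedModuleOp.Hom.f₁ hfg
  refine Hom.ext h₂ (C.splitExtension.hom_ext (fun a => ?_) fun b => ?_)
  · exact congrArg (fun k : TopGroupOp.Hom (kernel C.d₀) (kernel D.d₀) => kernelι D.d₀ (k a)) h₁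
  · exact (f.mor_ε b).trans ((congrArg (fun k : TopGroupOp.Hom C.Obj D.Obj => D.ε (k b)) h₂).trans
      (g.mor_ε b).symm)

/-- The morphism part of the internal functor of a morphism of crossed modules. -/
noncomputable def morOfCrossedModule (f : CrossedModuleOp.Hom C.crossedModule D.crossedModule) :
    TopGroupOp.Hom C.Mor D.Mor :=
  C.splitExtension.desc (f.f₁.comp (kernelι D.d₀)) (f.f₂.comp D.ε)
    (fun b a => by
      have h : C.splitExtension.conj b a = C.crossedModule.act b a :=
        C.splitExtension.i_injective (C.splitExtension.i_conj b a)
      rw [h]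
      exact congrArg (kernelι D.d₀).toFun (f.map_act b a))
    (fun o b a => by
      have h : C.splitExtension.binAct o b a = C.crossedModule.star o b a :=
        C.splitExtension.i_injective (C.splitExtension.i_binAct o b a)
      rw [h]
      exact congrArg (kernelι D.d₀).toFun (f.map_star o b a))

section

variable (f : CrossedModuleOp.Hom C.crossedModule D.crossedModule)

theorem morOfCrossedModule_kernelι (a : kernel C.d₀) :
    morOfCrossedModule f (kernelι C.d₀ a) = kernelι D.d₀ (f.f₁ a) :=
  C.splitExtension.desc_i ..

theorem morOfCrossedModule_ε (b : C.Obj) : morOfCrossedModule f (C.ε b) = D.ε (f.f₂ b) :=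
  C.splitExtension.desc_s ..

theorem d₀_morOfCrossedModule (a : C.Mor) : D.d₀ (morOfCrossedModule f a) = f.f₂ (C.d₀ a) := by
  have h : (morOfCrossedModule f).comp D.d₀ = C.d₀.comp f.f₂ :=
    C.splitExtension.hom_ext
      (fun a => by
        change D.d₀ (morOfCrossedModule f (kernelι C.d₀ a)) = f.f₂ (C.d₀ (kernelι C.d₀ a))
        rw [morOfCrossedModule_kernelι, map_kernelι, map_kernelι, TopGroupOp.Hom.map_zero])
      (fun b => by
        change D.d₀ (morOfCrossedModule f (C.ε b)) = f.f₂ (C.d₀ (C.ε b))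
        rw [morOfCrossedModule_ε, d₀_ε, d₀_ε])
  exact congrArg (fun k : TopGroupOp.Hom C.Mor D.Obj => k a) h

theorem d₁_morOfCrossedModule (a : C.Mor) : D.d₁ (morOfCrossedModule f a) = f.f₂ (C.d₁ a) := by
  have h : (morOfCrossedModule f).comp D.d₁ = C.d₁.comp f.f₂ :=
    C.splitExtension.hom_ext
      (fun a => by
        change D.d₁ (morOfCrossedModule f (kernelι C.d₀ a)) = f.f₂ (C.d₁ (kernelι C.d₀ a))
        rw [morOfCrossedModule_kernelι]
        exact (f.comm a).symm)
      (fun b => by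
        change D.d₁ (morOfCrossedModule f (C.ε b)) = f.f₂ (C.d₁ (C.ε b))
        rw [morOfCrossedModule_ε, d₁_ε, d₁_ε])
  exact congrArg (fun k : TopGroupOp.Hom C.Mor D.Obj => k a) h

/-- The internal functor of a morphism of crossed modules. -/
noncomputable def homOfCrossedModule : Hom C D where
  obj := f.f₂
  mor := morOfCrossedModule f
  d₀_mor := d₀_morOfCrossedModule f
  d₁_mor := d₁_morOfCrossedModule f
  mor_ε := morOfCrossedModule_ε f
  mor_comp a b h := by
    -- Composition is an expression in `+`, `-`, `ε` and `d₁`, all of which are preserved.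
    simp only [comp_eq, TopGroupOp.Hom.map_add, TopGroupOp.Hom.map_sub, morOfCrossedModule_ε,
      d₁_morOfCrossedModule]

theorem crossedModuleMap_homOfCrossedModule : (homOfCrossedModule f).crossedModuleMap = f :=
  CrossedModuleOp.Hom.ext
    (TopGroupOp.Hom.ext_apply fun a => kernelι_injective D.d₀ (morOfCrossedModule_kernelι f a)) rfl

end

instance : (toCrossedModule.{u} T).Faithful where
  map_injective h := Hom.crossedModuleMap_injective h

instance : (toCrossedModule.{u} T).Full where
  map_surjective f := ⟨homOfCrossedModule f, crossedModuleMap_homOfCrossedModule f⟩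

end InternalCatOp

/-! ### The internal category of a crossed module -/

namespace CrossedModuleOp

variable {T : OperationTheory.{v, w}} (X : CrossedModuleOp.{u} T)

/-- A split extension whose derived actions are the actions of the crossed module. -/
noncomputable def ext : SplitExtension X.A X.B := X.derived.2.2.choose

theorem i_act (b : X.B) (a : X.A) :
    X.ext.i (X.act b a) = X.ext.s b + X.ext.i a - X.ext.s b :=
  X.derived.2.2.choose_spec.1 b a

theorem i_star (o : T.Ω₂) (b : X.B) (a : X.A) :
    X.ext.i (X.star o b a) = X.ext.E.bin o (X.ext.s b) (X.ext.i a) :=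
  X.derived.2.2.choose_spec.2 o b a

theorem conj_ext (b : X.B) (a : X.A) : X.ext.conj b a = X.act b a :=
  X.ext.i_injective ((X.ext.i_conj b a).trans (X.i_act b a).symm)

theorem binAct_ext (o : T.Ω₂) (b : X.B) (a : X.A) : X.ext.binAct o b a = X.star o b a :=
  X.ext.i_injective ((X.ext.i_binAct o b a).trans (X.i_star o b a).symm)

/-- The target map `a + s b ↦ α a + b`. -/
noncomputable def target : TopGroupOp.Hom X.ext.E X.B :=
  X.ext.desc X.α (.id X.B) (fun b a => by rw [conj_ext]; exact X.cm1 b a)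
    (fun o b a => by rw [binAct_ext]; exact X.cm4_left o b a)

theorem target_apply (e : X.ext.E) : X.target e = X.α (X.ext.r e) + X.ext.p e := rfl

theorem target_i (a : X.A) : X.target (X.ext.i a) = X.α a := X.ext.desc_i ..

theorem target_s (b : X.B) : X.target (X.ext.s b) = b := X.ext.desc_s ..

/-- With `x = i a' + s b`, the target `α a' + b` acts as `b` followed by `α a'`; by `cm2` the latter
is conjugation by `a'`. -/
theorem i_act_target (x : X.ext.E) (a : X.A) :
    X.ext.i (X.act (X.target x) a) = x + X.ext.i a - x := by
  have h : X.ext.i (X.act (X.α (X.ext.r x)) (X.act (X.ext.p x) a)) = x + X.ext.i a - x := by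
    rw [cm2, TopGroupOp.Hom.map_sub, TopGroupOp.Hom.map_add, i_act]
    conv_rhs => rw [← X.ext.i_r_add x]
    simp only [sub_eq_add_neg, neg_add_rev, add_assoc]
  rw [← h, i_act, i_act, i_act, target_apply, TopGroupOp.Hom.map_add]
  simp only [sub_eq_add_neg, neg_add_rev, add_assoc]

theorem i_star_target (o : T.Ω₂) (x : X.ext.E) (a : X.A) :
    X.ext.i (X.star o (X.target x) a) = X.ext.E.bin o x (X.ext.i a) := by
  conv_rhs => rw [← X.ext.i_r_add x]
  rw [i_star, target_apply, TopGroupOp.Hom.map_add, add_bin, add_bin, ← i_star, cm3,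
    TopGroupOp.Hom.map_bin]

/-- Composition in the internal category of a crossed module. -/
noncomputable def compHom : TopGroupOp.Hom (pullback X.target X.ext.p) X.ext.E :=
  -- The formula dictated by `comp_eq'`, since `y - s (p y) = i (r y)`.
  TopGroupOp.Hom.mk' (fun q => X.ext.i (X.ext.r q.1.2) + q.1.1)
    (fun ⟨(x, y), h⟩ ⟨(x', y'), h'⟩ => by
      change X.target x = X.ext.p y at h
      change X.ext.i (X.ext.r (y + y')) + (x + x') =
        X.ext.i (X.ext.r y) + x + (X.ext.i (X.ext.r y') + x')
      -- As `p y = target x`, the action on `r y'` is conjugation by `x`, exactly what moves `i (r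
      -- y')` past `x`.
      rw [X.ext.r_add, conj_ext, ← h, TopGroupOp.Hom.map_add, i_act_target]
      simp only [sub_eq_add_neg, add_assoc, neg_add_cancel_left])
    (fun ω ⟨(x, y), h⟩ => by
      change X.ext.i (X.ext.r (X.ext.E.un ω y)) + X.ext.E.un ω x =
        X.ext.E.un ω (X.ext.i (X.ext.r y) + x)
      rw [X.ext.r_un, TopGroupOp.Hom.map_un, un_add])
    (fun o ⟨(x, y), h⟩ ⟨(x', y'), h'⟩ => by
      change X.target x = X.ext.p y at h
      change X.target x' = X.ext.p y' at h'
      change X.ext.i (X.ext.r (X.ext.E.bin o y y')) + X.ext.E.bin o x x' =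
        X.ext.E.bin o (X.ext.i (X.ext.r y) + x) (X.ext.i (X.ext.r y') + x')
      -- The two action terms become the mixed products `x ⋆ i (r y')` and `i (r y) ⋆ x'`.
      rw [X.ext.r_bin, binAct_ext, binAct_ext, ← h, ← h', TopGroupOp.Hom.map_add,
        TopGroupOp.Hom.map_add, i_star_target, i_star_target, TopGroupOp.Hom.map_bin]
      simp only [bin_opp, add_bin, bin_add, add_assoc])
    (((X.ext.i.continuous.comp X.ext.continuous_r).comp
      (continuous_snd.comp continuous_subtype_val)).add
      (continuous_fst.comp continuous_subtype_val))

theorem compHom_mk (x y : X.ext.E) (h : X.target x = X.ext.p y) :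
    X.compHom (pullback.mk x y h) = X.ext.i (X.ext.r y) + x := rfl

/-- The internal category of a crossed module. -/
noncomputable abbrev internalCat : InternalCatOp.{u} T where
  Obj := X.B
  Mor := X.ext.E
  d₀ := X.ext.p
  d₁ := X.target
  ε := X.ext.s
  comp := X.compHom
  d₀_ε := X.ext.p_s
  d₁_ε := X.target_s
  d₀_comp a b h := by
    rw [compHom_mk, TopGroupOp.Hom.map_add, X.ext.p_i, zero_add]
  d₁_comp a b h := by
    rw [compHom_mk, TopGroupOp.Hom.map_add, target_i, h, ← target_apply]
  ε_comp a := by rw [compHom_mk, X.ext.i_r_add]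
  comp_ε a := by rw [compHom_mk, X.ext.r_s, TopGroupOp.Hom.map_zero, zero_add]
  assoc a b c h h' := by
    have hr : X.ext.r (X.ext.i (X.ext.r c) + b) = X.ext.r c + X.ext.r b := by
      rw [X.ext.r_add, X.ext.r_i, X.ext.p_i, conj_ext]
      apply X.ext.i_injective
      rw [TopGroupOp.Hom.map_add, TopGroupOp.Hom.map_add, i_act, TopGroupOp.Hom.map_zero,
        zero_add, sub_zero]
    simp only [compHom_mk, hr, TopGroupOp.Hom.map_add, add_assoc]

/-- The isomorphism of the kernel of the source map with `A`. -/
noncomputable def kernelHom : TopGroupOp.Hom (kernel X.internalCat.d₀) X.A :=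
  TopGroupOp.Hom.mk' (fun a => X.ext.r (kernelι X.ext.p a))
    -- In general `r` is only a crossed homomorphism, but on the kernel of `p` it inverts `i`.
    (fun a b => X.ext.i_injective (by
      rw [X.ext.i.map_add, X.ext.i_r_of_p_eq_zero (map_kernelι X.ext.p a),
        X.ext.i_r_of_p_eq_zero (map_kernelι X.ext.p b)]
      exact X.ext.i_r_of_p_eq_zero (map_kernelι X.ext.p (a + b))))
    (fun ω a => X.ext.r_un ω (kernelι X.ext.p a))
    (fun o a b => X.ext.i_injective (by
      rw [X.ext.i.map_bin, X.ext.i_r_of_p_eq_zero (map_kernelι X.ext.p a),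
        X.ext.i_r_of_p_eq_zero (map_kernelι X.ext.p b)]
      exact X.ext.i_r_of_p_eq_zero (map_kernelι X.ext.p ((kernel X.ext.p).bin o a b))))
    (X.ext.continuous_r.comp (kernelι X.ext.p).continuous)

theorem i_kernelHom (a : kernel X.internalCat.d₀) :
    X.ext.i (X.kernelHom a) = kernelι X.internalCat.d₀ a :=
  X.ext.i_r_of_p_eq_zero (map_kernelι X.ext.p a)

/-- The inverse of `kernelHom`. -/
noncomputable def kernelInv : TopGroupOp.Hom X.A (kernel X.internalCat.d₀) :=
  TopGroupOp.Hom.mk' (fun a => kernel.mk (f := X.internalCat.d₀) (X.ext.i a) (X.ext.p_i a))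
    (fun a b => kernelι_injective _ (X.ext.i.map_add a b))
    (fun ω a => kernelι_injective _ (X.ext.i.map_un ω a))
    (fun o a b => kernelι_injective _ (X.ext.i.map_bin o a b))
    (kernel.continuous_mk (f := X.internalCat.d₀) X.ext.i.continuous X.ext.p_i)

/-- A crossed module is isomorphic to the crossed module of its internal category. -/
noncomputable def isoInternalCat : X.internalCat.crossedModule ≅ X where
  hom := {
    f₁ := X.kernelHom
    f₂ := .id X.B
    comm := fun a => by
      refine Eq.trans ?_ (X.target_i _)
      rw [i_kernelHom]; rfl
    map_act := fun b a => X.ext.i_injective (by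
      rw [i_act, i_kernelHom, i_kernelHom]; rfl)
    map_star := fun o b a => X.ext.i_injective (by
      rw [i_star, i_kernelHom, i_kernelHom]; rfl) }
  inv := {
    f₁ := X.kernelInv
    f₂ := .id X.B
    comm := fun a => (X.target_i a).symm
    map_act := fun b a => kernelι_injective X.internalCat.d₀ (X.i_act b a)
    map_star := fun o b a => kernelι_injective X.internalCat.d₀ (X.i_star o b a) }
  hom_inv_id := CrossedModuleOp.Hom.ext
    (TopGroupOp.Hom.ext_apply fun a => kernelι_injective X.internalCat.d₀ (X.i_kernelHom a)) rfl
  inv_hom_id := CrossedModuleOp.Hom.ext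
    (TopGroupOp.Hom.ext_apply fun a => X.ext.r_i a) rfl

end CrossedModuleOp

/-! ### The equivalences -/

namespace InternalCatOp

variable (T : OperationTheory.{v, w})

instance : (toCrossedModule.{u} T).EssSurj where
  mem_essImage X := ⟨X.internalCat, ⟨X.isoInternalCat⟩⟩

instance : (toCrossedModule.{u} T).IsEquivalence where

/-- Internal groupoids and internal categories form equivalent categories. -/
noncomputable def groupoidEquivalence : InternalGroupoidOp.{u} T ≌ InternalCatOp.{u} T :=
  -- Every internal category is already a groupoid, so the full inclusion is surjective on objects.
  have : (IsGroupoid.{u} (T := T)).ι.EssSurj := ⟨fun C => ⟨⟨C, C.isGroupoid⟩, ⟨Iso.refl C⟩⟩⟩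
  have : (IsGroupoid.{u} (T := T)).ι.IsEquivalence := {}
  (IsGroupoid.{u} (T := T)).ι.asEquivalence

/-- Crossed modules and internal categories form equivalent categories. -/
noncomputable def crossedModuleEquivalence : CrossedModuleOp.{u} T ≌ InternalCatOp.{u} T :=
  (toCrossedModule.{u} T).asEquivalence.symm

end InternalCatOp

theorem mainTheorem2 (T : OperationTheory.{v, w}) :
    Nonempty (CrossedModuleOp.{u} T ≌ InternalGroupoidOp.{u} T) ∧
      Nonempty (CrossedModuleOp.{u} T ≌ InternalCatOp.{u} T) :=
  ⟨⟨(InternalCatOp.crossedModuleEquivalence T).trans (InternalCatOp.groupoidEquivalence T).symm⟩,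
    ⟨InternalCatOp.crossedModuleEquivalence T⟩⟩
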